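/- Let $n\ge 3$ and let $D_n=\langle x,t \mid x^n=t^2=1,\ xt=tx^{-1}\rangle$ be the dihedral group of order $2n$. Let $\mathrm{Perm}(D_n)$ be the group of all permutations of the underlying set of $D_n$, and let $\lambda:D_n\to \mathrm{Perm}(D_n)$, $\lambda(g)(h)=gh$, be the left regular representation. A subgroup $N\le \mathrm{Perm}(D_n)$ is called regular if it acts transitively and fixed-point freely on $D_n$ (that is, only the identity of $N$ fixes a point). Let $R(D_n,[D_n])$ be the set of all regular subgroups $N\le \mathrm{Perm}(D_n)$ such that $N$ is isomorphic to $D_n$ and $\lambda(D_n)$ is contained in the normalizer of $N$ in $\mathrm{Perm}(D_n)$. Let $\Upsilon_n=\{u\in(\mathbb{Z}/n\mathbb{Z})^{\times} : u^2=1\}$. Then $$|R(D_n,[D_n])|=\begin{cases}\left(\frac n2+2\right)|\Upsilon_n| & \text{if } 8\mid n,\\[2pt] \left(\frac n2+1\right)|\Upsilon_n| & \text{if } 4\mid n \text{ but } 8\nmid n,\\[2pt] (n+1)|\Upsilon_n| & \text{if } 2\mid n \text{ but } 4\nmid n,\\[2pt] |\Upsilon_n| & \text{if } n \text{ is odd.}\end{cases}$$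 -/

import Mathlib

/-- A subgroup of `Equiv.Perm Z` is regular if it acts transitively and fixed-point freely on `Z`. -/
def IsRegularPermSubgroup {Z : Type*} (N : Subgroup (Equiv.Perm Z)) : Prop :=
  (∀ a b : Z, ∃ η ∈ N, η a = b) ∧ ∀ η ∈ N, ∀ a : Z, η a = a → η = 1

/-- The image `λ(G) ≤ Perm(G)` of the left regular representation `λ(g)(h) = g * h`. -/
def leftRegularImage (G : Type*) [Group G] : Subgroup (Equiv.Perm G) :=
  (MulAction.toPermHom G G).range

/-- `R(G)`: the regular subgroups `N ≤ Perm(G)` normalized by `λ(G)`. -/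
def regularNormalized (G : Type*) [Group G] : Set (Subgroup (Equiv.Perm G)) :=
  {N | IsRegularPermSubgroup N ∧ leftRegularImage G ≤ Subgroup.normalizer N}

/-- `R(G, [M])`: the members of `R(G)` that are isomorphic to `M`. -/
def regularNormalizedOfType (G M : Type*) [Group G] [Group M] :
    Set (Subgroup (Equiv.Perm G)) :=
  {N | N ∈ regularNormalized G ∧ Nonempty (N ≃* M)}

/-- `Υ_n`: the units `u` mod `n` with `u ^ 2 = 1`. -/
def unitsSquareOne (n : ℕ) : Set (ZMod n)ˣ :=
  {u | u ^ 2 = 1}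

/-!
Write `G` for the dihedral group, `L` for its left regular image and `H` for the normalizer of `L`
in `Perm(G)`, that is, the holomorph. A regular subgroup `N ≅ G` is conjugate to `L` by a
permutation `β` fixing `1`, which is unique up to the stabilizer of `1` in `H`, and `N` is
normalized by `L` exactly when `β` conjugates `L` into `H`. Such `β` correspond to homomorphisms
`h : G → H` for which `g ↦ h(g)(1)` is bijective, so the number of these homomorphisms is the
number of subgroups `N` times the order of the stabilizer
(`card_regularNormalizedOfType_mul`).

For `n ≥ 3` the holomorph consists of the permutations that are affine on rotations and on
reflections with a common slope, possibly exchanging the two classes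
(`DihedralGroup.mem_permHolomorph_iff_affine`); the stabilizer of `1` has order `n φ(n)`. A
homomorphism `h` is a pair `X = h(r 1)`, `T = h(sr 0)` subject to the dihedral relations.

* If `X` preserves the rotations, then `T` exchanges them with the reflections, and `X` has to act
  on the rotations as one cycle `a ↦ u a + c`. This makes `c` a unit and `u = 1`, or
  `u = 1 + n / 2` when `8 ∣ n`; the slope `v` of `T` is any square root of one and its translation
  is arbitrary. This gives `n φ(n) |Υ|` pairs for each admissible `u`.
* If `X` exchanges rotations and reflections, then `n` is even, and `T ↦ X T` reduces to the case
  where `T` preserves the rotations. Then `X ^ 2` is a translation by some `w` on the rotations,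
  which must generate the subgroup of index two, and `T` has slope `-1` and translates by an `e`
  outside this subgroup. This gives `2 · |Υ| · n · φ(n / 2) · (n / 2)` pairs.

Dividing by `n φ(n)` and comparing `φ(n / 2)` with `φ(n)` gives the count.
-/

open Function

/-! ### The holomorph and regular homomorphisms -/

/-- The holomorph of `G`, realized as the normalizer in `Perm(G)` of the left regular image. -/
abbrev permHolomorph (G : Type*) [Group G] : Subgroup (Equiv.Perm G) :=
  Subgroup.normalizer (leftRegularImage G)

/-- The point stabilizer of `1` in the holomorph; it is the automorphism group of `G`. -/
def holomorphStabilizer (G : Type*) [Group G] : Set (Equiv.Perm G) :=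
  {α | α ∈ permHolomorph G ∧ α 1 = 1}

/-- Homomorphisms from `G` to its holomorph whose image acts simply transitively, expressed by
bijectivity of the orbit map at `1`. -/
def regularHoms (G : Type*) [Group G] : Set (G →* Equiv.Perm G) :=
  {h | (∀ g, h g ∈ permHolomorph G) ∧ Bijective fun g => h g 1}

/-- Normalized permutations `β` that conjugate the left regular image into the holomorph. -/
def regularizingPerms (G : Type*) [Group G] : Set (Equiv.Perm G) :=
  {β | β 1 = 1 ∧ ∀ g, β * MulAction.toPermHom G G g * β⁻¹ ∈ permHolomorph G}

section Holomorph

variable {G : Type*} [Group G]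

theorem toPermHom_mem_leftRegularImage (g : G) :
    MulAction.toPermHom G G g ∈ leftRegularImage G := ⟨g, rfl⟩

theorem mem_permHolomorph_iff [Finite G] {σ : Equiv.Perm G} :
    σ ∈ permHolomorph G ↔
      ∀ g, ∃ g', σ * MulAction.toPermHom G G g = MulAction.toPermHom G G g' * σ := by
  constructor
  · intro h g
    obtain ⟨g', hg'⟩ := (Subgroup.mem_normalizer_iff.1 h _).1 (toPermHom_mem_leftRegularImage g)
    exact ⟨g', by rw [hg']; group⟩
  · intro h
    choose f hf using h
    have hf' : ∀ g, σ * MulAction.toPermHom G G g * σ⁻¹ = MulAction.toPermHom G G (f g) :=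
      fun g => by rw [hf]; group
    -- `f` is injective, hence surjective by finiteness, so `σ` conjugates the image onto itself.
    have hinj : Injective f := by
      intro a b hab
      have h1 : σ * MulAction.toPermHom G G a * σ⁻¹ = σ * MulAction.toPermHom G G b * σ⁻¹ := by
        rw [hf', hf', hab]
      have h2 := mul_left_cancel (mul_right_cancel h1)
      exact MulAction.toPerm_injective h2
    have hsurj := Finite.surjective_of_injective hinj
    refine Subgroup.mem_normalizer_iff.2 fun τ => ⟨?_, ?_⟩
    · rintro ⟨g, rfl⟩
      exact ⟨f g, (hf' g).symm⟩
    · rintro ⟨g, hg⟩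
      obtain ⟨k, rfl⟩ := hsurj g
      refine ⟨k, ?_⟩
      rw [← hf'] at hg
      exact mul_left_cancel (mul_right_cancel hg)

/-- Conjugating the regular representation by `β` matches regularizing permutations with regular
homomorphisms; the inverse sends `h` to its orbit map at `1`. -/
theorem card_regularizingPerms (G : Type*) [Group G] :
    Nat.card (regularizingPerms G) = Nat.card (regularHoms G) := by
  refine Nat.card_congr (Equiv.ofBijective
    (fun β => ⟨(MulAut.conj (β : Equiv.Perm G)).toMonoidHom.comp (MulAction.toPermHom G G),
      β.2.2, ?_⟩) ⟨?_, ?_⟩)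
  · have h1 : (β : Equiv.Perm G).symm 1 = 1 := by
      rw [Equiv.symm_apply_eq]; exact β.2.1.symm
    convert (β : Equiv.Perm G).bijective using 1
    ext g
    simp [h1]
  · rintro ⟨β, hβ, hβ'⟩ ⟨γ, hγ, hγ'⟩ h
    have h1 : β.symm 1 = 1 := by rw [Equiv.symm_apply_eq]; exact hβ.symm
    have h2 : γ.symm 1 = 1 := by rw [Equiv.symm_apply_eq]; exact hγ.symm
    ext g
    have := DFunLike.congr_fun (DFunLike.congr_fun (congrArg Subtype.val h) g) 1
    simpa [h1, h2] using this
  · rintro ⟨h, hh, hbij⟩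
    let β : Equiv.Perm G := Equiv.ofBijective _ hbij
    have hβ : ∀ g, β g = h g 1 := fun g => rfl
    have hconj : ∀ g, β * MulAction.toPermHom G G g * β⁻¹ = h g := by
      intro g
      rw [mul_inv_eq_iff_eq_mul]
      ext x
      simp [hβ]
    refine ⟨⟨β, ?_, fun g => ?_⟩, ?_⟩
    · simp [hβ]
    · rw [hconj]; exact hh g
    · ext g : 2
      exact hconj g

/-- Every regular subgroup isomorphic to `G` is conjugate, by a permutation fixing `1`, to the
left regular image; being normalized by `λ(G)` becomes the regularizing condition. -/
theorem exists_regularizingPerm {N : Subgroup (Equiv.Perm G)}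
    (hN : N ∈ regularNormalizedOfType G G) :
    ∃ β ∈ regularizingPerms G, (leftRegularImage G).comap (MulAut.conj β).toMonoidHom = N := by
  obtain ⟨⟨⟨htrans, hfree⟩, hnorm⟩, ⟨f⟩⟩ := hN
  have hbij : Bijective fun g : G => (f.symm g : Equiv.Perm G) 1 := by
    constructor
    · intro a b hab
      have h1 : (((f.symm b)⁻¹ * f.symm a : N) : Equiv.Perm G) = 1 := by
        refine hfree _ (Subtype.prop _) 1 ?_
        simpa [Equiv.symm_apply_eq] using hab
      have h2 : (f.symm b)⁻¹ * f.symm a = 1 := Subtype.ext h1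
      exact (f.symm.injective (inv_mul_eq_one.1 h2)).symm
    · intro b
      obtain ⟨η, hη, hb⟩ := htrans 1 b
      exact ⟨f ⟨η, hη⟩, by simpa using hb⟩
  let b : Equiv.Perm G := Equiv.ofBijective _ hbij
  have hb : ∀ g, b g = (f.symm g : Equiv.Perm G) 1 := fun g => rfl
  have hconj : ∀ g, b * MulAction.toPermHom G G g * b⁻¹ = f.symm g := by
    intro g
    rw [mul_inv_eq_iff_eq_mul]
    ext x
    simp [hb]
  have hcomap : (leftRegularImage G).comap (MulAut.conj b⁻¹).toMonoidHom = N := by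
    ext η
    constructor
    · rintro ⟨g, hg⟩
      have h1 : η = f.symm g := by
        rw [← hconj, hg]
        simp [mul_assoc]
      rw [h1]
      exact Subtype.prop _
    · intro hη
      refine ⟨f ⟨η, hη⟩, ?_⟩
      have := hconj (f ⟨η, hη⟩)
      simp only [MulEquiv.symm_apply_apply] at this
      refine Eq.trans ?_ (congrArg (fun x => b⁻¹ * x * b⁻¹⁻¹) this)
      group
  have hmem : ∀ η : Equiv.Perm G, η ∈ N ↔ b⁻¹ * η * b ∈ leftRegularImage G := by
    intro η
    rw [← hcomap]
    simp
  refine ⟨b⁻¹, ⟨?_, fun g => ?_⟩, hcomap⟩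
  · rw [Equiv.Perm.inv_eq_iff_eq]
    simp [hb]
  · refine Subgroup.mem_normalizer_iff.2 fun τ => ?_
    have h := Subgroup.mem_normalizer_iff.1 (hnorm (toPermHom_mem_leftRegularImage g))
      (b * τ * b⁻¹)
    have e1 : b⁻¹ * (b * τ * b⁻¹) * b = τ := by group
    rw [hmem, hmem, e1] at h
    rw [h, inv_inv]
    simp only [mul_inv_rev, inv_inv, mul_assoc]

theorem comap_conj_mem_regularNormalizedOfType {β : Equiv.Perm G}
    (hβ : β ∈ regularizingPerms G) :
    (leftRegularImage G).comap (MulAut.conj β).toMonoidHom ∈ regularNormalizedOfType G G := by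
  have hmem : ∀ η : Equiv.Perm G,
      η ∈ (leftRegularImage G).comap (MulAut.conj β).toMonoidHom ↔
        β * η * β⁻¹ ∈ leftRegularImage G := fun η => Iff.rfl
  refine ⟨⟨⟨fun x y => ?_, ?_⟩, ?_⟩, ⟨?_⟩⟩
  · refine ⟨β⁻¹ * MulAction.toPermHom G G (β y * (β x)⁻¹) * β, ?_, ?_⟩
    · rw [hmem]
      exact ⟨β y * (β x)⁻¹, by group⟩
    · simp
  · rintro η ⟨g, hg⟩ x hx
    have h1 : MulAction.toPermHom G G g (β x) = β x := by
      rw [hg]; simp [hx]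
    have h2 : g = 1 := by simpa using h1
    subst h2
    rw [map_one] at hg
    exact conj_eq_one_iff.1 hg.symm
  · rintro _ ⟨g, rfl⟩
    refine Subgroup.mem_normalizer_iff.2 fun τ => ?_
    have h := Subgroup.mem_normalizer_iff.1 (hβ.2 g) (β * τ * β⁻¹)
    rw [hmem, hmem, h]
    simp only [mul_inv_rev, inv_inv, mul_assoc, inv_mul_cancel_left]
  · let e : leftRegularImage G ≃* G :=
      (MonoidHom.ofInjective (f := MulAction.toPermHom G G) MulAction.toPerm_injective).symm
    exact ((MulEquiv.subgroupMap (MulAut.conj β)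
      ((leftRegularImage G).comap (MulAut.conj β).toMonoidHom)).trans
      (MulEquiv.subgroupCongr (Subgroup.map_comap_eq_self_of_surjective
        (MulAut.conj β).surjective _))).trans e

/-- Two normalized permutations give the same conjugate of the left regular image exactly when
they differ by an element of the holomorph, so the regular subgroups are counted by regular
homomorphisms up to the stabilizer of `1`. -/
theorem card_regularNormalizedOfType_mul (G : Type*) [Group G] :
    Nat.card (regularNormalizedOfType G G) * Nat.card (holomorphStabilizer G) =
      Nat.card (regularHoms G) := by
  rw [← card_regularizingPerms, ← Nat.card_prod]
  choose s hs hsN using fun N : regularNormalizedOfType G G => exists_regularizingPerm N.2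
  have hmem : ∀ (N : regularNormalizedOfType G G) (η : Equiv.Perm G),
      η ∈ N.1 ↔ s N * η * (s N)⁻¹ ∈ leftRegularImage G := by
    intro N η
    conv_lhs => rw [← hsN N]
    rfl
  refine Nat.card_congr (Equiv.ofBijective
    (fun p => ⟨p.2.1 * s p.1, ?_, fun g => ?_⟩) ⟨?_, ?_⟩)
  · rw [Equiv.Perm.mul_apply, (hs p.1).1, p.2.2.2]
  · have := mul_mem (mul_mem p.2.2.1 ((hs p.1).2 g)) (inv_mem p.2.2.1)
    convert this using 1
    simp only [mul_inv_rev, mul_assoc]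
  · rintro ⟨N, α, hα, hα1⟩ ⟨N', α', hα', hα1'⟩ h
    have h1 : α * s N = α' * s N' := congrArg Subtype.val h
    have hNN : N = N' := by
      apply Subtype.ext
      ext η
      rw [hmem, hmem]
      have k1 := Subgroup.mem_normalizer_iff.1 hα (s N * η * (s N)⁻¹)
      have k2 := Subgroup.mem_normalizer_iff.1 hα' (s N' * η * (s N')⁻¹)
      rw [k1, k2]
      have e : ∀ a b : Equiv.Perm G, a * (b * η * b⁻¹) * a⁻¹ = (a * b) * η * (a * b)⁻¹ := by
        intro a b; group
      rw [e, e, h1]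
    subst hNN
    have := mul_right_cancel h1
    subst this
    rfl
  · rintro ⟨β, hβ⟩
    let N : regularNormalizedOfType G G := ⟨_, comap_conj_mem_regularNormalizedOfType hβ⟩
    refine ⟨⟨N, β * (s N)⁻¹, ?_, ?_⟩, ?_⟩
    · refine Subgroup.mem_normalizer_iff.2 fun τ => ?_
      have k := hmem N ((s N)⁻¹ * τ * s N)
      have e1 : s N * ((s N)⁻¹ * τ * s N) * (s N)⁻¹ = τ := by group
      rw [e1] at k
      rw [← k]
      change β * ((s N)⁻¹ * τ * s N) * β⁻¹ ∈ leftRegularImage G ↔ _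
      simp only [mul_inv_rev, inv_inv, mul_assoc]
    · have h1 : (s N)⁻¹ 1 = 1 := by
        rw [Equiv.Perm.inv_eq_iff_eq]; exact (hs N).1.symm
      rw [Equiv.Perm.mul_apply, h1, hβ.1]
    · simp

end Holomorph

/-! ### The holomorph of the dihedral group as affine permutations -/

namespace DihedralGroup

variable {n : ℕ}

/-- The permutation of `DihedralGroup n` acting as `a ↦ u a + c` on rotations and as
`a ↦ u a + d` on reflections. -/
def affineDiag (u : (ZMod n)ˣ) (c d : ZMod n) : Equiv.Perm (DihedralGroup n) where
  toFun
    | r a => r (u * a + c)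
    | sr a => sr (u * a + d)
  invFun
    | r a => r (↑u⁻¹ * (a - c))
    | sr a => sr (↑u⁻¹ * (a - d))
  left_inv := by rintro (a | a) <;> simp
  right_inv := by rintro (a | a) <;> simp

/-- The permutation of `DihedralGroup n` exchanging rotations and reflections, acting as
`a ↦ u a + c` from rotations to reflections and as `a ↦ u a + d` from reflections to rotations. -/
def affineSwap (u : (ZMod n)ˣ) (c d : ZMod n) : Equiv.Perm (DihedralGroup n) where
  toFun
    | r a => sr (u * a + c)
    | sr a => r (u * a + d)
  invFun
    | sr a => r (↑u⁻¹ * (a - c))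
    | r a => sr (↑u⁻¹ * (a - d))
  left_inv := by rintro (a | a) <;> simp
  right_inv := by rintro (a | a) <;> simp

@[simp] theorem affineDiag_r (u : (ZMod n)ˣ) (c d a : ZMod n) :
    affineDiag u c d (r a) = r ((u : ZMod n) * a + c) := rfl

@[simp] theorem affineDiag_sr (u : (ZMod n)ˣ) (c d a : ZMod n) :
    affineDiag u c d (sr a) = sr ((u : ZMod n) * a + d) := rfl

@[simp] theorem affineSwap_r (u : (ZMod n)ˣ) (c d a : ZMod n) :
    affineSwap u c d (r a) = sr ((u : ZMod n) * a + c) := rfl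

@[simp] theorem affineSwap_sr (u : (ZMod n)ˣ) (c d a : ZMod n) :
    affineSwap u c d (sr a) = r ((u : ZMod n) * a + d) := rfl

theorem perm_ext {σ τ : Equiv.Perm (DihedralGroup n)} (h1 : ∀ a, σ (r a) = τ (r a))
    (h2 : ∀ a, σ (sr a) = τ (sr a)) : σ = τ := by
  ext (a | a)
  exacts [h1 a, h2 a]

theorem affineDiag_one : affineDiag (1 : (ZMod n)ˣ) 0 0 = 1 := by
  apply perm_ext <;> intro a <;> simp

theorem affineDiag_mul_affineDiag (u v : (ZMod n)ˣ) (c d e f : ZMod n) :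
    affineDiag u c d * affineDiag v e f = affineDiag (u * v) (u * e + c) (u * f + d) := by
  apply perm_ext <;> intro a <;> simp <;> ring

theorem affineDiag_mul_affineSwap (u v : (ZMod n)ˣ) (c d e f : ZMod n) :
    affineDiag u c d * affineSwap v e f = affineSwap (u * v) (u * e + d) (u * f + c) := by
  apply perm_ext <;> intro a <;> simp <;> ring

theorem affineSwap_mul_affineDiag (u v : (ZMod n)ˣ) (c d e f : ZMod n) :
    affineSwap u c d * affineDiag v e f = affineSwap (u * v) (u * e + c) (u * f + d) := by
  apply perm_ext <;> intro a <;> simp <;> ring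

theorem affineSwap_mul_affineSwap (u v : (ZMod n)ˣ) (c d e f : ZMod n) :
    affineSwap u c d * affineSwap v e f = affineDiag (u * v) (u * e + d) (u * f + c) := by
  apply perm_ext <;> intro a <;> simp <;> ring

theorem affineDiag_inj {u v : (ZMod n)ˣ} {c d e f : ZMod n} :
    affineDiag u c d = affineDiag v e f ↔ u = v ∧ c = e ∧ d = f := by
  refine ⟨fun h => ?_, by rintro ⟨rfl, rfl, rfl⟩; rfl⟩
  have h0 : c = e := by simpa [-r_zero] using DFunLike.congr_fun h (r 0)
  have h0' : d = f := by simpa using DFunLike.congr_fun h (sr 0)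
  have h1 := DFunLike.congr_fun h (r 1)
  subst h0
  simp only [affineDiag_r, mul_one, r.injEq, add_left_inj] at h1
  exact ⟨Units.ext h1, rfl, h0'⟩

theorem affineSwap_inj {u v : (ZMod n)ˣ} {c d e f : ZMod n} :
    affineSwap u c d = affineSwap v e f ↔ u = v ∧ c = e ∧ d = f := by
  refine ⟨fun h => ?_, by rintro ⟨rfl, rfl, rfl⟩; rfl⟩
  have h0 : c = e := by simpa [-r_zero] using DFunLike.congr_fun h (r 0)
  have h0' : d = f := by simpa using DFunLike.congr_fun h (sr 0)
  have h1 := DFunLike.congr_fun h (r 1)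
  subst h0
  simp only [affineSwap_r, mul_one, sr.injEq, add_left_inj] at h1
  exact ⟨Units.ext h1, rfl, h0'⟩

theorem affineDiag_ne_affineSwap (u v : (ZMod n)ˣ) (c d e f : ZMod n) :
    affineDiag u c d ≠ affineSwap v e f := fun h => by
  have := DFunLike.congr_fun h (r 0)
  simp [-r_zero] at this

theorem affineDiag_mem_permHolomorph [NeZero n] (u : (ZMod n)ˣ) (c d : ZMod n) :
    affineDiag u c d ∈ permHolomorph (DihedralGroup n) := by
  rw [mem_permHolomorph_iff]
  rintro (i | i)
  · refine ⟨r (u * i), perm_ext (fun a => ?_) (fun a => ?_)⟩ <;> simp <;> ring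
  · refine ⟨sr (u * i + d - c), perm_ext (fun a => ?_) (fun a => ?_)⟩ <;> simp <;> ring

theorem affineSwap_mem_permHolomorph [NeZero n] (u : (ZMod n)ˣ) (c d : ZMod n) :
    affineSwap u c d ∈ permHolomorph (DihedralGroup n) := by
  rw [mem_permHolomorph_iff]
  rintro (i | i)
  · refine ⟨r (-(u * i)), perm_ext (fun a => ?_) (fun a => ?_)⟩ <;> simp <;> ring
  · refine ⟨sr (c - d - u * i), perm_ext (fun a => ?_) (fun a => ?_)⟩ <;> simp <;> ring

/-- For `n ≥ 3` the rotations are preserved by the holomorph, since an element of order `n` is a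
rotation; hence `σ` is affine on each coset of the rotation subgroup, with a common slope. -/
theorem mem_permHolomorph_iff_affine [NeZero n] (hn : 3 ≤ n)
    {σ : Equiv.Perm (DihedralGroup n)} :
    σ ∈ permHolomorph (DihedralGroup n) ↔
      (∃ u c d, σ = affineDiag u c d) ∨ ∃ u c d, σ = affineSwap u c d := by
  refine ⟨fun hσ => ?_, ?_⟩
  swap
  · rintro (⟨u, c, d, rfl⟩ | ⟨u, c, d, rfl⟩)
    exacts [affineDiag_mem_permHolomorph u c d, affineSwap_mem_permHolomorph u c d]
  obtain ⟨g, hg⟩ := mem_permHolomorph_iff.1 hσ (r 1)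
  have hpow : ∀ k : ℕ, σ * MulAction.toPermHom _ _ (r (1 : ZMod n) ^ k) =
      MulAction.toPermHom _ _ (g ^ k) * σ := by
    intro k
    induction k with
    | zero => rw [pow_zero, pow_zero, map_one, mul_one, one_mul]
    | succ k ih => rw [pow_succ, map_mul, ← mul_assoc, ih, mul_assoc, hg, pow_succ, map_mul,
        mul_assoc]
  have happ : ∀ (k : ℕ) (x : DihedralGroup n), σ (r 1 ^ k * x) = g ^ k * σ x := fun k x =>
    DFunLike.congr_fun (hpow k) x
  obtain ⟨j, rfl⟩ : ∃ j, g = r j := by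
    rcases g with j | j
    · exact ⟨j, rfl⟩
    · exfalso
      have h1 := happ 2 1
      have h2 : (sr j : DihedralGroup n) ^ 2 = 1 := by rw [sq, sr_mul_self]
      rw [h2, one_mul, σ.injective.eq_iff, mul_one] at h1
      have h3 := Nat.le_of_dvd two_pos (orderOf_dvd_of_pow_eq_one h1)
      rw [orderOf_r_one] at h3
      omega
  have happ' : ∀ a x, σ (r a * x) = r (j * a) * σ x := by
    intro a x
    have := happ a.val x
    rwa [r_one_pow, r_pow, ZMod.natCast_zmod_val] at this
  have hr : ∀ a, σ (r a) = r (j * a) * σ (r 0) := fun a => by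
    rw [← happ', r_mul_r, add_zero]
  have hs : ∀ a, σ (sr a) = r (j * -a) * σ (sr 0) := fun a => by
    rw [← happ', r_mul_sr, sub_neg_eq_add, zero_add]
  have hj : IsUnit j := by
    have hinj : Injective fun a : ZMod n => j * a := by
      intro a b hab
      have hab' : j * a = j * b := hab
      have : σ (r a) = σ (r b) := by rw [hr, hr b, hab']
      simpa using σ.injective this
    obtain ⟨k, hk⟩ := Finite.surjective_of_injective hinj 1
    exact IsUnit.of_mul_eq_one k hk
  obtain ⟨u, rfl⟩ := hj
  rcases h0 : σ (r 0) with c | c <;> rcases h1 : σ (sr 0) with d | d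
  · exfalso
    obtain ⟨(x | x), hx⟩ := σ.surjective (sr 0)
    · rw [hr, h0] at hx; simp at hx
    · rw [hs, h1] at hx; simp at hx
  · refine Or.inl ⟨u, c, d, perm_ext (fun a => ?_) (fun a => ?_)⟩
    · rw [hr, h0]; simp
    · rw [hs, h1]; simp; ring
  · refine Or.inr ⟨-u, c, d, perm_ext (fun a => ?_) (fun a => ?_)⟩
    · rw [hr, h0]; simp; ring
    · rw [hs, h1]; simp
  · exfalso
    obtain ⟨(x | x), hx⟩ := σ.surjective (r 0)
    · rw [hr, h0] at hx; simp [-r_zero] at hx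
    · rw [hs, h1] at hx; simp [-r_zero] at hx

theorem card_holomorphStabilizer [NeZero n] (hn : 3 ≤ n) :
    Nat.card (holomorphStabilizer (DihedralGroup n)) = n.totient * n := by
  have h : Nat.card ((ZMod n)ˣ × ZMod n) = n.totient * n := by
    rw [Nat.card_prod, Nat.card_eq_fintype_card, ZMod.card_units_eq_totient, Nat.card_zmod]
  rw [← h]
  symm
  refine Nat.card_congr (Equiv.ofBijective
    (fun p => ⟨affineDiag p.1 0 p.2, affineDiag_mem_permHolomorph _ _ _, ?_⟩) ⟨?_, ?_⟩)
  · rw [← r_zero]; simp [-r_zero]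
  · rintro ⟨u, d⟩ ⟨v, f⟩ h
    obtain ⟨rfl, -, rfl⟩ := affineDiag_inj.1 (congrArg Subtype.val h)
    rfl
  · rintro ⟨σ, hσ, h1⟩
    rw [← r_zero] at h1
    rcases (mem_permHolomorph_iff_affine hn).1 hσ with ⟨u, c, d, rfl⟩ | ⟨u, c, d, rfl⟩
    · have hc : c = 0 := by simpa [-r_zero] using h1
      subst hc
      exact ⟨(u, d), rfl⟩
    · simp [-r_zero] at h1

/-! ### Regular homomorphisms as pairs of generators -/

/-- There is a homomorphism out of the dihedral group sending `r 1` to `x` and `sr 0` to `t`. -/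
theorem exists_hom_of_relations {M : Type*} [Group M] {x t : M} (hx : x ^ n = 1) (ht : t * t = 1)
    (hxt : x * t * x = t) :
    ∃ h : DihedralGroup n →* M, h (r 1) = x ∧ h (sr 0) = t := by
  let ψ : ZMod n →+ Additive M := ZMod.lift n
    ⟨zmultiplesHom (Additive M) (Additive.ofMul x), by simpa using congrArg Additive.ofMul hx⟩
  let φ : ZMod n → M := fun a => (ψ a).toMul
  have hφ : ∀ k : ℤ, φ k = x ^ k := fun k => by simp [φ, ψ]
  have hadd : ∀ a b, φ (a + b) = φ a * φ b := fun a b => by simp [φ]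
  have hzero : φ 0 = 1 := by simp [φ]
  have hcomm : ∀ a, φ a * t = t * φ (-a) := by
    intro a
    obtain ⟨k, rfl⟩ := ZMod.intCast_surjective a
    rw [← Int.cast_neg, hφ, hφ, zpow_neg, ← inv_zpow]
    have h1 : SemiconjBy t x⁻¹ x := by
      change t * x⁻¹ = x * t
      rw [mul_inv_eq_iff_eq_mul, hxt]
    exact (h1.zpow_right k).symm
  refine ⟨⟨⟨fun g => match g with
    | r a => φ a
    | sr a => t * φ a, hzero⟩, ?_⟩, ?_, ?_⟩
  · rintro (a | a) (b | b)
    · exact hadd a b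
    · change t * φ (b - a) = φ a * (t * φ b)
      rw [← mul_assoc, hcomm, mul_assoc, ← hadd, sub_eq_neg_add]
    · change t * φ (a + b) = t * φ a * φ b
      rw [hadd, mul_assoc]
    · change φ (b - a) = t * φ a * (t * φ b)
      rw [mul_assoc, ← mul_assoc (φ a), hcomm, ← mul_assoc, ← mul_assoc, ht, one_mul, ← hadd,
        sub_eq_neg_add]
  · change φ 1 = x
    simpa using hφ 1
  · change t * φ 0 = t
    rw [hzero, mul_one]

/-- Pairs `(X, T)` in the holomorph satisfying the dihedral relations and whose orbit map
at `1` is onto. -/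
def regularPairs (n : ℕ) :
    Set (Equiv.Perm (DihedralGroup n) × Equiv.Perm (DihedralGroup n)) :=
  {p | (p.1 ∈ permHolomorph (DihedralGroup n) ∧ p.2 ∈ permHolomorph (DihedralGroup n)) ∧
    p.1 ^ n = 1 ∧ p.2 * p.2 = 1 ∧ p.1 * p.2 * p.1 = p.2 ∧
    ∀ q, ∃ i : ℤ, (p.1 ^ i) 1 = q ∨ p.2 ((p.1 ^ i) 1) = q}

theorem card_regularHoms_eq_card_regularPairs [NeZero n] :
    Nat.card (regularHoms (DihedralGroup n)) = Nat.card (regularPairs n) := by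
  have hgen_r : ∀ (h : DihedralGroup n →* Equiv.Perm (DihedralGroup n)) (i : ℤ),
      h (r i) = h (r 1) ^ i := fun h i => by rw [← map_zpow, r_one_zpow]
  have hgen_sr : ∀ (h : DihedralGroup n →* Equiv.Perm (DihedralGroup n)) (i : ℤ),
      h (sr i) = h (sr 0) * h (r 1) ^ i := fun h i => by
    rw [← hgen_r, ← map_mul, sr_mul_r, zero_add]
  refine Nat.card_congr (Equiv.ofBijective
    (fun h => ⟨((h : DihedralGroup n →* _) (r 1), (h : DihedralGroup n →* _) (sr 0)),
      ⟨h.2.1 _, h.2.1 _⟩, ?_, ?_, ?_, fun q => ?_⟩) ⟨?_, ?_⟩)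
  · rw [← map_pow, r_one_pow_n, map_one]
  · rw [← map_mul, sr_mul_self, map_one]
  · rw [← map_mul, ← map_mul]
    simp
  · obtain ⟨(a | a), rfl⟩ := h.2.2.surjective q
    · obtain ⟨k, rfl⟩ := ZMod.intCast_surjective a
      exact ⟨k, Or.inl (by simp [hgen_r])⟩
    · obtain ⟨k, rfl⟩ := ZMod.intCast_surjective a
      exact ⟨k, Or.inr (by simp [hgen_sr])⟩
  · rintro ⟨h, hh⟩ ⟨h', hh'⟩ heq
    have heq' := congrArg Subtype.val heq
    have e1 : h (r 1) = h' (r 1) := congrArg Prod.fst heq'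
    have e2 : h (sr 0) = h' (sr 0) := congrArg Prod.snd heq'
    apply Subtype.ext
    apply MonoidHom.ext
    rintro (a | a)
    · obtain ⟨k, rfl⟩ := ZMod.intCast_surjective a
      rw [hgen_r, e1, ← hgen_r]
    · obtain ⟨k, rfl⟩ := ZMod.intCast_surjective a
      rw [hgen_sr, e1, e2, ← hgen_sr]
  · rintro ⟨⟨X, T⟩, ⟨hX, hT⟩, hXn, hTT, hXT, horb⟩
    obtain ⟨h, h1, h2⟩ := exists_hom_of_relations hXn hTT hXT
    simp only at hX hT horb
    refine ⟨⟨h, ?_, ?_⟩, ?_⟩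
    · rintro (a | a)
      · obtain ⟨k, rfl⟩ := ZMod.intCast_surjective a
        rw [hgen_r, h1]
        exact zpow_mem hX k
      · obtain ⟨k, rfl⟩ := ZMod.intCast_surjective a
        rw [hgen_sr, h1, h2]
        exact mul_mem hT (zpow_mem hX k)
    · rw [← Finite.surjective_iff_bijective]
      intro q
      obtain ⟨i, hi | hi⟩ := horb q
      · exact ⟨r i, by simp only [hgen_r, h1, hi]⟩
      · exact ⟨sr i, by simp only [hgen_sr, h1, h2, Equiv.Perm.mul_apply, hi]⟩
    · simp only [h1, h2]

/-! ### Powers of affine permutations -/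

theorem affineDiag_one_zpow (c d : ZMod n) (k : ℤ) :
    affineDiag 1 c d ^ k = affineDiag (n := n) 1 (k * c) (k * d) := by
  let φ : Multiplicative (ZMod n × ZMod n) →* Equiv.Perm (DihedralGroup n) :=
    { toFun := fun p => affineDiag 1 p.toAdd.1 p.toAdd.2
      map_one' := affineDiag_one
      map_mul' := fun p q => by
        rw [affineDiag_mul_affineDiag, affineDiag_inj]
        simp [add_comm] }
  have := map_zpow φ (Multiplicative.ofAdd (c, d)) k
  rw [← ofAdd_zsmul] at this
  simpa [φ] using this.symm

theorem affineDiag_zpow_two_mul {u : (ZMod n)ˣ} (hu : u * u = 1) (c d : ZMod n) (k : ℤ) :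
    affineDiag u c d ^ (2 * k) =
      affineDiag (n := n) 1 (k * (1 + u) * c) (k * (1 + u) * d) := by
  rw [zpow_mul, zpow_ofNat, sq, affineDiag_mul_affineDiag, hu, affineDiag_one_zpow, affineDiag_inj]
  refine ⟨rfl, by ring, by ring⟩

theorem affineDiag_zpow_two_mul_add_one {u : (ZMod n)ˣ} (hu : u * u = 1) (c d : ZMod n) (k : ℤ) :
    affineDiag u c d ^ (2 * k + 1) =
      affineDiag (n := n) u (c + k * (1 + u) * c) (d + k * (1 + u) * d) := by
  rw [zpow_add_one, affineDiag_zpow_two_mul hu, affineDiag_mul_affineDiag, affineDiag_inj]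
  simp

theorem affineSwap_zpow_two_mul {u : (ZMod n)ˣ} (hu : u * u = 1) (c d : ZMod n) (k : ℤ) :
    affineSwap u c d ^ (2 * k) =
      affineDiag (n := n) 1 (k * (u * c + d)) (k * (u * d + c)) := by
  rw [zpow_mul, zpow_ofNat, sq, affineSwap_mul_affineSwap, hu, affineDiag_one_zpow]

theorem affineSwap_zpow_two_mul_add_one {u : (ZMod n)ˣ} (hu : u * u = 1) (c d : ZMod n) (k : ℤ) :
    affineSwap u c d ^ (2 * k + 1) =
      affineSwap (n := n) u (c + k * (u * d + c)) (d + k * (u * c + d)) := by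
  rw [zpow_add_one, affineSwap_zpow_two_mul hu, affineDiag_mul_affineSwap, affineSwap_inj]
  simp

/-! ### Square roots of one generating a single cycle -/

/-- The slopes `u` of order dividing two for which `a ↦ u a + 1` permutes `ZMod n` in a single
cycle. -/
def cyclicSlopes (n : ℕ) : Set (ZMod n)ˣ :=
  {u | u * u = 1 ∧ ∀ y : ZMod n, ∃ k : ℤ, y = k * (1 + u) ∨ y = 1 + k * (1 + u)}

/-- Besides `1`, the only such slope is `1 + n / 2`, and only when `8 ∣ n`. -/
theorem mem_cyclicSlopes_iff [NeZero n] {u : (ZMod n)ˣ} :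
    u ∈ cyclicSlopes n ↔ u = 1 ∨ ∃ q : ℕ, n = 8 * q ∧ (u : ZMod n) = 1 + 4 * q := by
  constructor
  · rintro ⟨huu, h⟩
    have huu' : (u : ZMod n) * u = 1 := by
      rw [← Units.val_mul, huu, Units.val_one]
    by_cases hu1 : u = 1
    · exact Or.inl hu1
    right
    set a : ZMod n := u - 1 with ha
    have hu : (u : ZMod n) = 1 + a := by rw [ha]; ring
    have ha0 : a ≠ 0 := fun h0 => hu1 (Units.ext (by rw [hu, h0]; simp))
    obtain ⟨k, hk⟩ := h 2
    have h2a : 2 * a = 0 := by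
      rcases hk with hk | hk
      · linear_combination a * hk + k * huu'
      · exfalso
        apply ha0
        linear_combination a * hk + k * huu'
    -- `a` is the element of order two, so it is the class of `n / 2`.
    obtain ⟨m, hm⟩ : ∃ m : ℕ, m = a.val := ⟨_, rfl⟩
    have ham : a = (m : ZMod n) := by rw [hm, ZMod.natCast_zmod_val]
    have hmlt : m < n := hm ▸ ZMod.val_lt a
    have hm0 : m ≠ 0 := fun h0 => ha0 (by rw [ham, h0, Nat.cast_zero])
    have hn : n = 2 * m := by
      have h1 : ((2 * m : ℕ) : ZMod n) = 0 := by push_cast; rw [← ham, h2a]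
      obtain ⟨t, ht⟩ := (ZMod.natCast_eq_zero_iff _ _).1 h1
      have : t = 1 := by
        have h2 : t < 2 := by
          by_contra hlt
          have : n * 2 ≤ n * t := Nat.mul_le_mul_left n (not_lt.1 hlt)
          omega
        have h3 : t ≠ 0 := by rintro rfl; omega
        omega
      rw [this] at ht; omega
    -- `(1 + m) ^ 2 = 1` modulo `2 m` makes `m` even.
    obtain ⟨q, rfl⟩ : ∃ q, m = 2 * q := by
      have h1 : ((m * m : ℕ) : ZMod n) = 0 := by
        push_cast
        rw [← ham]
        rw [hu] at huu'
        linear_combination huu' - h2a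
      obtain ⟨t, ht⟩ := (ZMod.natCast_eq_zero_iff _ _).1 h1
      rw [hn, mul_assoc, mul_comm m t, ← mul_assoc] at ht
      exact ⟨t, Nat.eq_of_mul_eq_mul_right (Nat.pos_of_ne_zero hm0) ht⟩
    have hcast : ∀ z : ℤ, (z : ZMod n) = 0 → ∃ t : ℤ, z = (4 * q : ℤ) * t := by
      intro z hz
      obtain ⟨t, ht⟩ := (ZMod.intCast_zmod_eq_zero_iff_dvd z n).1 hz
      refine ⟨t, ?_⟩
      rw [ht, hn]; push_cast; ring
    -- Reducing modulo four the witness for `2` makes `m / 2` even.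
    rcases Nat.even_or_odd' q with ⟨s, rfl | rfl⟩
    · refine ⟨s, by omega, ?_⟩
      rw [hu, ham]; push_cast; ring
    · exfalso
      rw [hu, ham] at hk
      rcases hk with hk | hk
      · obtain ⟨t, ht⟩ := hcast (2 - k * (2 + 2 * (2 * s + 1))) (by
          push_cast at hk ⊢
          linear_combination hk)
        push_cast at ht
        have h4 : 2 = 4 * ((2 * s + 1) * t + k * (s + 1)) := by linear_combination ht
        generalize ((2 * s + 1) * t + k * (s + 1)) = z at h4
        omega
      · obtain ⟨t, ht⟩ := hcast (1 - k * (2 + 2 * (2 * s + 1))) (by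
          push_cast at hk ⊢
          linear_combination hk)
        push_cast at ht
        have h4 : 1 = 4 * ((2 * s + 1) * t + k * (s + 1)) := by linear_combination ht
        generalize ((2 * s + 1) * t + k * (s + 1)) = z at h4
        omega
  · rintro (rfl | ⟨q, hn, hu⟩)
    · refine ⟨one_mul 1, fun y => ?_⟩
      obtain ⟨z, rfl⟩ := ZMod.intCast_surjective y
      obtain ⟨k, rfl | rfl⟩ := Int.even_or_odd' z
      · exact ⟨k, Or.inl (by push_cast; ring)⟩
      · exact ⟨k, Or.inr (by push_cast; ring)⟩
    · have h8 : (8 * q : ZMod n) = 0 := by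
        have : ((8 * q : ℕ) : ZMod n) = 0 := by rw [← hn, ZMod.natCast_self]
        simpa using this
      refine ⟨Units.ext ?_, fun y => ?_⟩
      · rw [Units.val_mul, hu, Units.val_one]
        linear_combination (1 + 2 * (q : ZMod n)) * h8
      · obtain ⟨z, rfl⟩ := ZMod.intCast_surjective y
        rw [hu]
        obtain ⟨k, rfl | rfl⟩ := Int.even_or_odd' z
        · refine ⟨k * (1 - 2 * q), Or.inl ?_⟩
          push_cast
          linear_combination (k * q : ZMod n) * h8
        · refine ⟨k * (1 - 2 * q), Or.inr ?_⟩
          push_cast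
          linear_combination (k * q : ZMod n) * h8

theorem cyclicSlopes_eq_singleton [NeZero n] (h : ¬ 8 ∣ n) : cyclicSlopes n = {1} := by
  ext u
  rw [mem_cyclicSlopes_iff, Set.mem_singleton_iff]
  refine or_iff_left ?_
  rintro ⟨q, hq, -⟩
  exact h ⟨q, hq⟩

theorem card_cyclicSlopes_of_eight_dvd [NeZero n] (h : 8 ∣ n) :
    Nat.card (cyclicSlopes n) = 2 := by
  obtain ⟨q, hn⟩ := h
  have h8 : (8 * q : ZMod n) = 0 := by
    have : ((8 * q : ℕ) : ZMod n) = 0 := by rw [← hn, ZMod.natCast_self]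
    simpa using this
  have hsq : (1 + 4 * q : ZMod n) * (1 + 4 * q) = 1 := by
    linear_combination (1 + 2 * (q : ZMod n)) * h8
  let u : (ZMod n)ˣ := ⟨1 + 4 * q, 1 + 4 * q, hsq, hsq⟩
  have hu : u ≠ 1 := by
    intro hu1
    have h1 : (1 + 4 * q : ZMod n) = 1 := congrArg Units.val hu1
    have h4 : ((4 * q : ℕ) : ZMod n) = 0 := by push_cast; linear_combination h1
    have hle := Nat.le_of_dvd (by have := NeZero.ne n; omega) ((ZMod.natCast_eq_zero_iff _ _).1 h4)
    have := NeZero.ne n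
    omega
  have hset : cyclicSlopes n = {1, u} := by
    ext v
    rw [mem_cyclicSlopes_iff, Set.mem_insert_iff, Set.mem_singleton_iff]
    refine or_congr_right ⟨?_, ?_⟩
    · rintro ⟨q', hq', hv⟩
      obtain rfl : q' = q := by omega
      exact Units.ext hv
    · rintro rfl
      exact ⟨q, hn, rfl⟩
  rw [hset, Nat.card_coe_set_eq, Set.ncard_pair hu.symm]

/-! ### Generators with `X` preserving the rotations -/

/-- Here the rotations reached are the powers of `X` applied to `r 0`, so `X` must permute them in
a single cycle; the relations then determine how `X` and `T` act on the reflections. -/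
theorem affineDiag_affineSwap_mem_regularPairs_iff [NeZero n] {u v : (ZMod n)ˣ}
    {c d e f : ZMod n} :
    (affineDiag u c d, affineSwap v e f) ∈ regularPairs n ↔
      v ^ 2 = 1 ∧ f = -(v * e) ∧ d = (1 - u) * e - u * v * c ∧ IsUnit c ∧ u ∈ cyclicSlopes n := by
  constructor
  · rintro ⟨-, -, hTT, hXT, horb⟩
    simp only at hTT hXT horb
    rw [affineSwap_mul_affineSwap, ← affineDiag_one, affineDiag_inj] at hTT
    rw [affineDiag_mul_affineSwap, affineSwap_mul_affineDiag, affineSwap_inj] at hXT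
    obtain ⟨hvv, h1, h2⟩ := hTT
    obtain ⟨huv, h3, h4⟩ := hXT
    have huu : u * u = 1 := by
      rw [mul_right_comm] at huv
      exact mul_eq_right.1 huv
    have hy : ∀ y : ZMod n, ∃ k : ℤ, y = k * (1 + u) * c ∨ y = c + k * (1 + u) * c := by
      intro y
      obtain ⟨i, hi⟩ := horb (r y)
      rw [← r_zero] at hi
      obtain ⟨k, rfl | rfl⟩ := Int.even_or_odd' i
      · rw [affineDiag_zpow_two_mul huu] at hi
        exact ⟨k, Or.inl (by simpa [-r_zero, eq_comm] using hi)⟩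
      · rw [affineDiag_zpow_two_mul_add_one huu] at hi
        exact ⟨k, Or.inr (by simpa [-r_zero, eq_comm] using hi)⟩
    have hc : IsUnit c := by
      obtain ⟨k, hk | hk⟩ := hy 1
      · exact IsUnit.of_mul_eq_one (k * (1 + u)) (by linear_combination -hk)
      · refine IsUnit.of_mul_eq_one (1 + k * (1 + u)) ?_
        linear_combination -hk
    refine ⟨by rw [sq, hvv], by linear_combination h1, ?_, hc, huu, fun y => ?_⟩
    · push_cast at h3
      linear_combination h3
    · obtain ⟨k, hk⟩ := hy (y * c)
      refine ⟨k, hk.imp (fun h => hc.mul_left_injective h) fun h => hc.mul_left_injective ?_⟩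
      linear_combination h
  · rintro ⟨hv, rfl, rfl, hc, hu⟩
    have huu := hu.1
    have huu' : (u : ZMod n) * u = 1 := by
      rw [← Units.val_mul, huu, Units.val_one]
    rw [sq] at hv
    have hvv' : (v : ZMod n) * v = 1 := by
      rw [← Units.val_mul, hv, Units.val_one]
    refine ⟨⟨affineDiag_mem_permHolomorph _ _ _, affineSwap_mem_permHolomorph _ _ _⟩,
      ?_, ?_, ?_, ?_⟩
    · rcases mem_cyclicSlopes_iff.1 hu with rfl | ⟨q, hn, huq⟩
      · rw [← zpow_natCast, affineDiag_one_zpow, ← affineDiag_one, affineDiag_inj]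
        simp
      · have h8 : (8 * q : ZMod n) = 0 := by
          have : ((8 * q : ℕ) : ZMod n) = 0 := by rw [← hn, ZMod.natCast_self]
          simpa using this
        have h0 : ((4 * q : ℤ) : ZMod n) * (1 + u) = 0 := by
          rw [huq]; push_cast; linear_combination (1 + 2 * (q : ZMod n)) * h8
        have hn' : (n : ℤ) = 2 * (4 * q : ℤ) := by rw [hn]; push_cast; ring
        rw [← zpow_natCast, hn', affineDiag_zpow_two_mul huu, ← affineDiag_one, affineDiag_inj, h0]
        simp
    · rw [affineSwap_mul_affineSwap, ← affineDiag_one, affineDiag_inj]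
      refine ⟨hv, by ring, by linear_combination -e * hvv'⟩
    · rw [affineDiag_mul_affineSwap, affineSwap_mul_affineDiag, affineSwap_inj]
      refine ⟨by rw [mul_right_comm, huu, one_mul], ?_, ?_⟩
      · push_cast
        ring
      · push_cast
        linear_combination (-e * v * huu' - c * v * v * huu' - c * hvv')
    · have hr : ∀ y, ∃ i : ℤ,
          (affineDiag u c ((1 - u) * e - u * v * c) ^ i) 1 = r y := by
        intro y
        obtain ⟨z, hz⟩ : ∃ z, z * c = y := ⟨y * ↑hc.unit⁻¹, by simp [mul_assoc]⟩
        obtain ⟨k, hk | hk⟩ := hu.2 z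
        · refine ⟨2 * k, ?_⟩
          rw [affineDiag_zpow_two_mul huu, ← r_zero, affineDiag_r, ← hz, hk]
          simp
        · refine ⟨2 * k + 1, ?_⟩
          rw [affineDiag_zpow_two_mul_add_one huu, ← r_zero, affineDiag_r, ← hz, hk]
          simp [add_mul]
      rintro (y | y)
      · obtain ⟨i, hi⟩ := hr y
        exact ⟨i, Or.inl hi⟩
      · obtain ⟨i, hi⟩ := hr (v * (y - e))
        refine ⟨i, Or.inr ?_⟩
        simp only [hi, affineSwap_r, sr.injEq]
        linear_combination (y - e) * hvv'

/-- The regular pairs whose first component preserves the set of rotations, parametrized by the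
slope and translation of `X` and those of `T`. -/
def diagSwapPair (p : cyclicSlopes n × (ZMod n)ˣ × unitsSquareOne n × ZMod n) :
    Equiv.Perm (DihedralGroup n) × Equiv.Perm (DihedralGroup n) :=
  let u := p.1.1
  let c : ZMod n := p.2.1
  let v := p.2.2.1.1
  let e := p.2.2.2
  (affineDiag u c ((1 - u) * e - u * v * c), affineSwap v e (-(v * e)))

theorem diagSwapPair_injective : Injective (diagSwapPair (n := n)) := by
  rintro ⟨⟨u, hu⟩, c, ⟨v, hv⟩, e⟩ ⟨⟨u', hu'⟩, c', ⟨v', hv'⟩, e'⟩ h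
  obtain ⟨rfl, hc, -⟩ := affineDiag_inj.1 (congrArg Prod.fst h)
  obtain ⟨rfl, he, -⟩ := affineSwap_inj.1 (congrArg Prod.snd h)
  obtain rfl : c = c' := Units.ext hc
  obtain rfl : e = e' := he
  rfl

theorem card_range_diagSwapPair [NeZero n] :
    (Set.range (diagSwapPair (n := n))).ncard =
      Nat.card (cyclicSlopes n) * ((unitsSquareOne n).ncard * (n.totient * n)) := by
  rw [← Nat.card_coe_set_eq, Nat.card_range_of_injective diagSwapPair_injective,
    Nat.card_prod, Nat.card_prod, Nat.card_prod, Nat.card_coe_set_eq (unitsSquareOne n),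
    Nat.card_eq_fintype_card (α := (ZMod n)ˣ), ZMod.card_units_eq_totient, Nat.card_zmod]
  ring

theorem mem_range_diagSwapPair_iff [NeZero n] {u v : (ZMod n)ˣ} {c d e f : ZMod n} :
    (affineDiag u c d, affineSwap v e f) ∈ Set.range (diagSwapPair (n := n)) ↔
      (affineDiag u c d, affineSwap v e f) ∈ regularPairs n := by
  rw [affineDiag_affineSwap_mem_regularPairs_iff]
  constructor
  · rintro ⟨⟨⟨u', hu⟩, c', ⟨v', hv⟩, e'⟩, h⟩
    obtain ⟨rfl, rfl, rfl⟩ := affineDiag_inj.1 (congrArg Prod.fst h)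
    obtain ⟨rfl, rfl, rfl⟩ := affineSwap_inj.1 (congrArg Prod.snd h)
    exact ⟨hv, rfl, rfl, c'.isUnit, hu⟩
  · rintro ⟨hv, rfl, rfl, ⟨c, rfl⟩, hu⟩
    exact ⟨⟨⟨u, hu⟩, c, ⟨v, hv⟩, e⟩, rfl⟩

/-! ### Generators with `X` exchanging rotations and reflections -/

/-- If the multiples of `w`, at most `n / 2` in number, cover `ZMod n` together with their
translates by `e`, then they form the subgroup of index two and `e` lies outside of it. -/
theorem addOrderOf_eq_half_of_cover [NeZero n] (h2 : 2 ∣ n) {w e : ZMod n}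
    (hw : (n / 2) • w = 0)
    (h : ∀ y, y ∈ AddSubgroup.zmultiples w ∨ y - e ∈ AddSubgroup.zmultiples w) :
    addOrderOf w = n / 2 ∧ e ∉ AddSubgroup.zmultiples w := by
  have hpos : 0 < n := NeZero.pos n
  have hdvd : addOrderOf w ∣ n / 2 := addOrderOf_dvd_of_nsmul_eq_zero hw
  have hle := Nat.le_of_dvd (by omega) hdvd
  have he : e ∉ AddSubgroup.zmultiples w := by
    intro he
    have htop : AddSubgroup.zmultiples w = ⊤ := by
      rw [eq_top_iff]
      intro y _
      rcases h y with hy | hy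
      · exact hy
      · simpa using add_mem hy he
    have hcard := Nat.card_zmultiples w
    rw [htop, AddSubgroup.card_top, Nat.card_zmod] at hcard
    omega
  have hindex : (AddSubgroup.zmultiples w).index = 2 := by
    rw [AddSubgroup.index_eq_two_iff]
    refine ⟨-e, fun b => ?_⟩
    rw [← sub_eq_add_neg]
    rcases h b with hb | hb
    · refine Or.inr ⟨hb, fun hb' => he ?_⟩
      simpa using sub_mem hb hb'
    · refine Or.inl ⟨hb, fun hb' => he ?_⟩
      simpa using sub_mem hb' hb
  have hcard := AddSubgroup.card_mul_index (AddSubgroup.zmultiples w)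
  rw [hindex, Nat.card_zmultiples, Nat.card_zmod] at hcard
  exact ⟨by omega, he⟩

theorem index_zmultiples_eq_two [NeZero n] (h2 : 2 ∣ n) {w : ZMod n}
    (hw : addOrderOf w = n / 2) : (AddSubgroup.zmultiples w).index = 2 := by
  have hpos : 0 < n := NeZero.pos n
  have hcard := AddSubgroup.card_mul_index (AddSubgroup.zmultiples w)
  rw [Nat.card_zmultiples, Nat.card_zmod, hw] at hcard
  obtain ⟨m, rfl⟩ := h2
  rw [Nat.mul_div_cancel_left m two_pos] at hcard
  exact Nat.eq_of_mul_eq_mul_left (by omega) (hcard.trans (mul_comm 2 m))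

theorem two_dvd_of_affineSwap_pow_eq_one {u : (ZMod n)ˣ} (huu : u * u = 1) {c d : ZMod n}
    (h : affineSwap u c d ^ n = 1) : 2 ∣ n := by
  obtain ⟨k, hk | hk⟩ := Nat.even_or_odd' n
  · exact ⟨k, hk⟩
  · exfalso
    have hk' : (n : ℤ) = 2 * (k : ℤ) + 1 := by omega
    rw [← zpow_natCast, hk', affineSwap_zpow_two_mul_add_one huu, ← affineDiag_one] at h
    exact affineDiag_ne_affineSwap _ _ _ _ _ _ h.symm

/-- Here `X ^ 2` translates the rotations by `w = u c + d`, so the rotations reached are the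
`k w` and the `e - k w`; regularity forces `T` to have slope `-1` and `w` to generate the subgroup
of index two. -/
theorem affineSwap_affineDiag_mem_regularPairs_iff [NeZero n] {u v : (ZMod n)ˣ}
    {c d e f : ZMod n} :
    (affineSwap u c d, affineDiag v e f) ∈ regularPairs n ↔
      2 ∣ n ∧ u ^ 2 = 1 ∧ v = -1 ∧ f = u * (e + u * c - d) ∧
        addOrderOf (u * c + d) = n / 2 ∧ e ∉ AddSubgroup.zmultiples (u * c + d) := by
  constructor
  · rintro ⟨-, hXn, hTT, hXT, horb⟩
    simp only at hXn hTT hXT horb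
    rw [affineDiag_mul_affineDiag, ← affineDiag_one, affineDiag_inj] at hTT
    rw [affineSwap_mul_affineDiag, affineSwap_mul_affineSwap, affineDiag_inj] at hXT
    obtain ⟨hvv, h1, h2⟩ := hTT
    obtain ⟨huv, h3, -⟩ := hXT
    have huu : u * u = 1 := by
      rw [mul_right_comm] at huv
      exact mul_eq_right.1 huv
    have huu' : (u : ZMod n) * u = 1 := by
      rw [← Units.val_mul, huu, Units.val_one]
    have hvv' : (v : ZMod n) * v = 1 := by
      rw [← Units.val_mul, hvv, Units.val_one]
    have h2n := two_dvd_of_affineSwap_pow_eq_one huu hXn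
    push_cast at h3
    have hy : ∀ y : ZMod n, ∃ k : ℤ, y = k * (u * c + d) ∨ y = v * (k * (u * c + d)) + e := by
      intro y
      obtain ⟨i, hi⟩ := horb (r y)
      rw [← r_zero] at hi
      obtain ⟨k, rfl | rfl⟩ := Int.even_or_odd' i
      · rw [affineSwap_zpow_two_mul huu] at hi
        exact ⟨k, by simpa [-r_zero, eq_comm] using hi⟩
      · rw [affineSwap_zpow_two_mul_add_one huu] at hi
        simp [-r_zero] at hi
    -- `v + 1` kills both `w = u c + d` and `e`, hence every element of the orbit, hence `1`.
    have hw : (v + 1 : ZMod n) * (u * c + d) = 0 := by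
      linear_combination (v + 1 : ZMod n) * h3 + h1 - u * h2 - u * c * hvv'
    have hv : (v : ZMod n) = -1 := by
      obtain ⟨k, hk | hk⟩ := hy 1
      · linear_combination (v + 1 : ZMod n) * hk + k * hw
      · linear_combination (v + 1 : ZMod n) * hk + v * k * hw + h1
    obtain rfl : v = -1 := Units.ext (by rw [hv]; simp)
    have hhalf : (n / 2) • (u * c + d) = 0 := by
      have hn' : (n : ℤ) = 2 * ((n / 2 : ℕ) : ℤ) := by omega
      rw [← zpow_natCast, hn', affineSwap_zpow_two_mul huu, ← affineDiag_one,
        affineDiag_inj] at hXn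
      rw [nsmul_eq_mul]
      exact_mod_cast hXn.2.1
    refine ⟨h2n, by rw [sq, huu], rfl, ?_, addOrderOf_eq_half_of_cover h2n hhalf fun y => ?_⟩
    · simp only [Units.val_neg, Units.val_one] at h3
      linear_combination u * h3 - f * huu'
    · obtain ⟨k, hk | hk⟩ := hy y
      · exact Or.inl ⟨k, by simp [hk, mul_add]⟩
      · refine Or.inr ⟨-k, ?_⟩
        simp [hk, mul_add]
  · rintro ⟨h2n, hu, rfl, rfl, hord, he⟩
    have huu : u * u = 1 := by rw [← sq, hu]
    have huu' : (u : ZMod n) * u = 1 := by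
      rw [← Units.val_mul, huu, Units.val_one]
    have hXT : affineSwap u c d * affineDiag (-1) e (u * (e + u * c - d)) * affineSwap u c d =
        affineDiag (-1) e (u * (e + u * c - d)) := by
      rw [affineSwap_mul_affineDiag, affineSwap_mul_affineSwap, affineDiag_inj]
      refine ⟨by rw [mul_neg_one, neg_mul, huu], ?_, ?_⟩
      · push_cast
        linear_combination (e + u * c - d) * huu'
      · push_cast
        linear_combination -c * huu'
    refine ⟨⟨affineSwap_mem_permHolomorph _ _ _, affineDiag_mem_permHolomorph _ _ _⟩,
      ?_, ?_, hXT, ?_⟩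
    · have hn' : (n : ℤ) = 2 * ((n / 2 : ℕ) : ℤ) := by omega
      have h0 : ((n / 2 : ℕ) : ZMod n) * (u * c + d) = 0 := by
        rw [← nsmul_eq_mul, ← hord, addOrderOf_nsmul_eq_zero]
      rw [← zpow_natCast, hn', affineSwap_zpow_two_mul huu, ← affineDiag_one, affineDiag_inj]
      refine ⟨rfl, by exact_mod_cast h0, ?_⟩
      rw [Int.cast_natCast]
      linear_combination u * h0 - ((n / 2 : ℕ) : ZMod n) * c * huu'
    · rw [affineDiag_mul_affineDiag, ← affineDiag_one, affineDiag_inj]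
      simp
    · have hr : ∀ y, ∃ i : ℤ, (affineSwap u c d ^ i) 1 = r y ∨
          affineDiag (-1) e (u * (e + u * c - d)) ((affineSwap u c d ^ i) 1) = r y := by
        intro y
        by_cases hy : y ∈ AddSubgroup.zmultiples (u * c + d)
        · obtain ⟨k, hk⟩ := hy
          refine ⟨2 * k, Or.inl ?_⟩
          rw [affineSwap_zpow_two_mul huu, ← r_zero, affineDiag_r, ← hk]
          simp [mul_add]
        · have hye : y + -e ∈ AddSubgroup.zmultiples (u * c + d) := by
            rw [AddSubgroup.add_mem_iff_of_index_two (index_zmultiples_eq_two h2n hord),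
              neg_mem_iff]
            exact iff_of_false hy he
          obtain ⟨k, hk⟩ := hye
          refine ⟨2 * -k, Or.inr ?_⟩
          rw [affineSwap_zpow_two_mul huu, ← r_zero, affineDiag_r, affineDiag_r, r.injEq]
          simp only [zsmul_eq_mul] at hk
          push_cast
          linear_combination hk
      rintro (y | y)
      · exact hr y
      · -- Apply `X` to a rotation in the orbit, moving it past `T` by `X T = T X⁻¹`.
        obtain ⟨i, hi⟩ := hr (u * (y - c))
        have hXy : affineSwap u c d (r (u * (y - c))) = sr y := by
          rw [affineSwap_r, sr.injEq]
          linear_combination (y - c) * huu'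
        rcases hi with hi | hi
        · refine ⟨1 + i, Or.inl ?_⟩
          rw [zpow_one_add, Equiv.Perm.mul_apply, hi, hXy]
        · refine ⟨-1 + i, Or.inr ?_⟩
          rw [zpow_add, zpow_neg_one, Equiv.Perm.mul_apply, ← Equiv.Perm.mul_apply,
            ← eq_mul_inv_iff_mul_eq.2 hXT, Equiv.Perm.mul_apply, hi, hXy]

/-- The regular pairs with `X` exchanging rotations and reflections and `T` preserving them.
The parameter `w` is the translation by which `X ^ 2` acts on rotations. -/
def swapDiagPair (p : unitsSquareOne n × ZMod n ×
    Σ w : {w : ZMod n // addOrderOf w = n / 2}, {e : ZMod n // e ∉ AddSubgroup.zmultiples w.1}) :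
    Equiv.Perm (DihedralGroup n) × Equiv.Perm (DihedralGroup n) :=
  let u := p.1.1
  let c := p.2.1
  let w := p.2.2.1.1
  let e := p.2.2.2.1
  (affineSwap u c (w - u * c), affineDiag (-1) e (u * (e + u * c - (w - u * c))))

theorem swapDiagPair_injective : Injective (swapDiagPair (n := n)) := by
  rintro ⟨⟨u, hu⟩, c, ⟨w, hw⟩, ⟨e, he⟩⟩ ⟨⟨u', hu'⟩, c', ⟨w', hw'⟩, ⟨e', he'⟩⟩ h
  obtain ⟨rfl, rfl, h1⟩ := affineSwap_inj.1 (congrArg Prod.fst h)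
  obtain ⟨-, rfl, -⟩ := affineDiag_inj.1 (congrArg Prod.snd h)
  obtain rfl : w = w' := sub_left_injective h1
  rfl

theorem mem_range_swapDiagPair_iff [NeZero n] (h2n : 2 ∣ n) {u v : (ZMod n)ˣ}
    {c d e f : ZMod n} :
    (affineSwap u c d, affineDiag v e f) ∈ Set.range (swapDiagPair (n := n)) ↔
      (affineSwap u c d, affineDiag v e f) ∈ regularPairs n := by
  rw [affineSwap_affineDiag_mem_regularPairs_iff]
  constructor
  · rintro ⟨⟨⟨u', hu⟩, c', ⟨w, hw⟩, ⟨e', he⟩⟩, h⟩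
    obtain ⟨rfl, rfl, rfl⟩ := affineSwap_inj.1 (congrArg Prod.fst h)
    obtain ⟨rfl, rfl, rfl⟩ := affineDiag_inj.1 (congrArg Prod.snd h)
    simp only at he
    simp only [add_sub_cancel]
    exact ⟨h2n, hu, trivial, trivial, hw, he⟩
  · rintro ⟨-, hu, rfl, rfl, hw, he⟩
    refine ⟨⟨⟨u, hu⟩, c, ⟨_, hw⟩, ⟨e, he⟩⟩, ?_⟩
    simp [swapDiagPair]

theorem card_range_swapDiagPair [NeZero n] (h2n : 2 ∣ n) :
    (Set.range (swapDiagPair (n := n))).ncard =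
      (unitsSquareOne n).ncard * (n * ((n / 2).totient * (n / 2))) := by
  classical
  have hcompl : ∀ w : {w : ZMod n // addOrderOf w = n / 2},
      Nat.card {e : ZMod n // e ∉ AddSubgroup.zmultiples w.1} = n / 2 := by
    rintro ⟨w, hw⟩
    have h1 := Set.ncard_add_ncard_compl (AddSubgroup.zmultiples w : Set (ZMod n))
    rw [Nat.card_zmod, ← Nat.card_coe_set_eq] at h1
    have h3 : Nat.card ((AddSubgroup.zmultiples w : Set (ZMod n)) : Type) = n / 2 := by
      rw [← hw]; exact Nat.card_zmultiples w
    rw [h3] at h1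
    have h4 : Nat.card {e : ZMod n // e ∉ AddSubgroup.zmultiples w} =
      (AddSubgroup.zmultiples w : Set (ZMod n))ᶜ.ncard := Nat.card_coe_set_eq _
    rw [h4]
    omega
  have hgen : Nat.card {w : ZMod n // addOrderOf w = n / 2} = (n / 2).totient := by
    rw [Nat.card_eq_fintype_card, Fintype.card_subtype]
    refine IsAddCyclic.card_addOrderOf_eq_totient ?_
    rw [ZMod.card]
    exact Nat.div_dvd_of_dvd h2n
  rw [← Nat.card_coe_set_eq, Nat.card_range_of_injective swapDiagPair_injective,
    Nat.card_prod, Nat.card_prod, Nat.card_sigma, Nat.card_zmod,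
    Nat.card_coe_set_eq (unitsSquareOne n)]
  simp only [hcompl, Finset.sum_const, Finset.card_univ, smul_eq_mul]
  rw [← Nat.card_eq_fintype_card, hgen]

/-- Replacing the reflection `T` by the reflection `X T` preserves regular pairs. -/
theorem mul_mem_regularPairs_iff {X T : Equiv.Perm (DihedralGroup n)} :
    (X, X * T) ∈ regularPairs n ↔ (X, T) ∈ regularPairs n := by
  have hrel : X * (X * T) * X = X * T ↔ X * T * X = T := by
    rw [mul_assoc X (X * T) X, mul_right_inj]
  have hsq : X * T * X = T → X * T * (X * T) = T * T := fun h => by rw [← mul_assoc, h]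
  have horb : X * T * X = T → ∀ (i : ℤ) x, T ((X ^ i) x) = (X * T) ((X ^ (1 + i)) x) := by
    intro h i x
    rw [zpow_one_add, Equiv.Perm.mul_apply X (X ^ i), ← Equiv.Perm.mul_apply (X * T), h]
  constructor
  · rintro ⟨⟨hX, hT⟩, hn, hTT, hXT, ho⟩
    have hXT' := hrel.1 hXT
    refine ⟨⟨hX, (Subgroup.mul_mem_cancel_left _ hX).1 hT⟩, hn, (hsq hXT').symm.trans hTT, hXT',
      fun q => ?_⟩
    obtain ⟨i, hi | hi⟩ := ho q
    · exact ⟨i, Or.inl hi⟩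
    · refine ⟨-1 + i, Or.inr ?_⟩
      rw [horb hXT', add_neg_cancel_left]
      exact hi
  · rintro ⟨⟨hX, hT⟩, hn, hTT, hXT, ho⟩
    refine ⟨⟨hX, mul_mem hX hT⟩, hn, (hsq hXT).trans hTT, hrel.2 hXT, fun q => ?_⟩
    obtain ⟨i, hi | hi⟩ := ho q
    · exact ⟨i, Or.inl hi⟩
    · refine ⟨1 + i, Or.inr ?_⟩
      rw [← horb hXT]
      exact hi

/-! ### The count -/

theorem affineDiag_affineDiag_notMem_regularPairs [NeZero n] {u v : (ZMod n)ˣ} {c d e f : ZMod n} :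
    (affineDiag u c d, affineDiag v e f) ∉ regularPairs n := by
  rintro ⟨-, -, -, -, horb⟩
  have hpow : ∀ k : ℕ, ∃ a, (affineDiag u c d ^ k) 1 = r a := by
    intro k
    induction k with
    | zero => exact ⟨0, rfl⟩
    | succ k ih =>
      obtain ⟨a, ha⟩ := ih
      exact ⟨u * a + c, by rw [pow_succ', Equiv.Perm.mul_apply, ha, affineDiag_r]⟩
  obtain ⟨i, hi⟩ := horb (sr 0)
  obtain ⟨k, hk⟩ : ∃ k : ℕ, affineDiag u c d ^ k = affineDiag u c d ^ i := by
    have := mem_powers_iff_mem_zpowers (x := affineDiag u c d) (y := affineDiag u c d ^ i)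
    exact this.2 ⟨i, rfl⟩
  obtain ⟨a, ha⟩ := hpow k
  simp only [← hk, ha] at hi
  simp at hi

theorem regularPairs_eq_of_odd [NeZero n] (hn : 3 ≤ n) (hodd : ¬ 2 ∣ n) :
    regularPairs n = Set.range (diagSwapPair (n := n)) := by
  ext ⟨X, T⟩
  constructor
  · intro h
    rcases (mem_permHolomorph_iff_affine hn).1 h.1.1 with ⟨u, c, d, rfl⟩ | ⟨u, c, d, rfl⟩ <;>
    rcases (mem_permHolomorph_iff_affine hn).1 h.1.2 with ⟨v, e, f, rfl⟩ | ⟨v, e, f, rfl⟩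
    · exact absurd h affineDiag_affineDiag_notMem_regularPairs
    · exact mem_range_diagSwapPair_iff.2 h
    · exact absurd (affineSwap_affineDiag_mem_regularPairs_iff.1 h).1 hodd
    · rw [← mul_mem_regularPairs_iff, affineSwap_mul_affineSwap] at h
      exact absurd (affineSwap_affineDiag_mem_regularPairs_iff.1 h).1 hodd
  · rintro ⟨p, hp⟩
    rw [← hp]
    exact mem_range_diagSwapPair_iff.1 ⟨p, rfl⟩

theorem regularPairs_eq_of_even [NeZero n] (hn : 3 ≤ n) (h2n : 2 ∣ n) :
    regularPairs n = Set.range (diagSwapPair (n := n)) ∪ (Set.range (swapDiagPair (n := n)) ∪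
      (fun p => (p.1, p.1⁻¹ * p.2)) '' Set.range (swapDiagPair (n := n))) := by
  ext ⟨X, T⟩
  constructor
  · intro h
    rcases (mem_permHolomorph_iff_affine hn).1 h.1.1 with ⟨u, c, d, rfl⟩ | ⟨u, c, d, rfl⟩ <;>
    rcases (mem_permHolomorph_iff_affine hn).1 h.1.2 with ⟨v, e, f, rfl⟩ | ⟨v, e, f, rfl⟩
    · exact absurd h affineDiag_affineDiag_notMem_regularPairs
    · exact Or.inl (mem_range_diagSwapPair_iff.2 h)
    · exact Or.inr (Or.inl ((mem_range_swapDiagPair_iff h2n).2 h))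
    · refine Or.inr (Or.inr ⟨(affineSwap u c d, affineSwap u c d * affineSwap v e f), ?_, ?_⟩)
      · rw [← mul_mem_regularPairs_iff] at h
        rw [affineSwap_mul_affineSwap] at h ⊢
        exact (mem_range_swapDiagPair_iff h2n).2 h
      · simp only [inv_mul_cancel_left]
  · rintro (⟨p, hp⟩ | ⟨p, hp⟩ | ⟨_, ⟨p, rfl⟩, hp⟩)
    · rw [← hp]
      exact mem_range_diagSwapPair_iff.1 ⟨p, rfl⟩
    · rw [← hp]
      exact (mem_range_swapDiagPair_iff h2n).1 ⟨p, rfl⟩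
    · rw [← hp, ← mul_mem_regularPairs_iff]
      simp only [mul_inv_cancel_left]
      exact (mem_range_swapDiagPair_iff h2n).1 ⟨p, rfl⟩

theorem card_regularPairs_of_even [NeZero n] (hn : 3 ≤ n) (h2n : 2 ∣ n) :
    Nat.card (regularPairs n) =
      Nat.card (cyclicSlopes n) * ((unitsSquareOne n).ncard * (n.totient * n)) +
        2 * ((unitsSquareOne n).ncard * (n * ((n / 2).totient * (n / 2)))) := by
  have hinj : Injective fun p : Equiv.Perm (DihedralGroup n) × Equiv.Perm (DihedralGroup n) =>
      (p.1, p.1⁻¹ * p.2) := by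
    rintro ⟨X, T⟩ ⟨X', T'⟩ h
    obtain rfl : X = X' := congrArg Prod.fst h
    obtain rfl : T = T' := mul_left_cancel (congrArg Prod.snd h)
    rfl
  rw [Nat.card_coe_set_eq, regularPairs_eq_of_even hn h2n, Set.ncard_union_eq, Set.ncard_union_eq,
    Set.ncard_image_of_injective _ hinj, card_range_diagSwapPair, card_range_swapDiagPair h2n]
  · ring
  · rw [Set.disjoint_left]
    rintro _ ⟨p, rfl⟩ ⟨_, ⟨q, rfl⟩, h⟩
    -- `X⁻¹ * T` exchanges rotations and reflections, while the second component of
    -- `swapDiagPair p` preserves them.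
    have h1 : (swapDiagPair q).1 = (swapDiagPair p).1 := (Prod.ext_iff.1 h).1
    have h2 : (swapDiagPair q).1⁻¹ * (swapDiagPair q).2 = (swapDiagPair p).2 :=
      (Prod.ext_iff.1 h).2
    rw [inv_mul_eq_iff_eq_mul, swapDiagPair, swapDiagPair, affineSwap_mul_affineDiag] at h2
    exact affineDiag_ne_affineSwap _ _ _ _ _ _ h2
  · rw [Set.disjoint_left]
    rintro _ ⟨p, rfl⟩ (⟨q, h⟩ | ⟨_, ⟨q, rfl⟩, h⟩)
    · exact affineDiag_ne_affineSwap _ _ _ _ _ _ (congrArg Prod.fst h).symm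
    · have h1 : (swapDiagPair q).1 = (diagSwapPair p).1 := (Prod.ext_iff.1 h).1
      exact affineDiag_ne_affineSwap _ _ _ _ _ _ h1.symm

theorem ncard_regularNormalizedOfType_of_odd (hn : 3 ≤ n) (hodd : ¬ 2 ∣ n) :
    (regularNormalizedOfType (DihedralGroup n) (DihedralGroup n)).ncard =
      (unitsSquareOne n).ncard := by
  have : NeZero n := ⟨by omega⟩
  have hpos : 0 < n.totient * n := Nat.mul_pos (Nat.totient_pos.2 (by omega)) (by omega)
  have h := card_regularNormalizedOfType_mul (DihedralGroup n)
  rw [card_holomorphStabilizer hn, card_regularHoms_eq_card_regularPairs, Nat.card_coe_set_eq,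
    Nat.card_coe_set_eq, regularPairs_eq_of_odd hn hodd, card_range_diagSwapPair,
    cyclicSlopes_eq_singleton fun h8 => hodd (dvd_trans (by norm_num) h8)] at h
  simp only [Nat.card_coe_set_eq, Set.ncard_singleton, one_mul] at h
  exact Nat.eq_of_mul_eq_mul_right hpos h

/-- The count for even `n`, with `n φ(n / 2)` expressed as `k φ(n)`. -/
theorem ncard_regularNormalizedOfType_of_even (hn : 3 ≤ n) (h2n : 2 ∣ n) {k : ℕ}
    (hk : n * (n / 2).totient = k * n.totient) :
    (regularNormalizedOfType (DihedralGroup n) (DihedralGroup n)).ncard =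
      (k + Nat.card (cyclicSlopes n)) * (unitsSquareOne n).ncard := by
  have : NeZero n := ⟨by omega⟩
  have hpos : 0 < n.totient * n := Nat.mul_pos (Nat.totient_pos.2 (by omega)) (by omega)
  have h := card_regularNormalizedOfType_mul (DihedralGroup n)
  rw [card_holomorphStabilizer hn, card_regularHoms_eq_card_regularPairs,
    Nat.card_coe_set_eq (regularNormalizedOfType _ _), card_regularPairs_of_even hn h2n] at h
  refine Nat.eq_of_mul_eq_mul_right hpos (h.trans ?_)
  have hhalf : 2 * (n / 2) = n := Nat.mul_div_cancel' h2n
  calc _ = Nat.card (cyclicSlopes n) * ((unitsSquareOne n).ncard * (n.totient * n)) +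
        (unitsSquareOne n).ncard * ((n * (n / 2).totient) * (2 * (n / 2))) := by ring
    _ = _ := by rw [hk, hhalf]; ring

theorem mul_totient_half_of_four_dvd (h : 4 ∣ n) :
    n * (n / 2).totient = (n / 2) * n.totient := by
  obtain ⟨q, rfl⟩ := h
  have h1 : 4 * q / 2 = 2 * q := by omega
  have h2 : (4 * q).totient = 2 * (2 * q).totient := by
    rw [show 4 * q = 2 * (2 * q) by ring, Nat.totient_two_mul_of_even (even_two_mul q)]
  rw [h1, h2]
  ring

theorem mul_totient_half_of_not_four_dvd (h2 : 2 ∣ n) (h : ¬ 4 ∣ n) :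
    n * (n / 2).totient = n * n.totient := by
  obtain ⟨q, rfl⟩ := h2
  have hodd : Odd q := by
    rw [← Nat.not_even_iff_odd]
    rintro ⟨s, rfl⟩
    exact h ⟨s, by ring⟩
  rw [Nat.mul_div_cancel_left q two_pos, Nat.totient_two_mul_of_odd hodd]

end DihedralGroup

theorem mainTheorem1 (n : ℕ) (hn : 3 ≤ n) :
    (8 ∣ n →
      (regularNormalizedOfType (DihedralGroup n) (DihedralGroup n)).ncard =
        (n / 2 + 2) * (unitsSquareOne n).ncard) ∧
    (4 ∣ n → ¬ 8 ∣ n →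
      (regularNormalizedOfType (DihedralGroup n) (DihedralGroup n)).ncard =
        (n / 2 + 1) * (unitsSquareOne n).ncard) ∧
    (2 ∣ n → ¬ 4 ∣ n →
      (regularNormalizedOfType (DihedralGroup n) (DihedralGroup n)).ncard =
        (n + 1) * (unitsSquareOne n).ncard) ∧
    (Odd n →
      (regularNormalizedOfType (DihedralGroup n) (DihedralGroup n)).ncard =
        (unitsSquareOne n).ncard) := by
  have : NeZero n := ⟨by omega⟩
  have hone : ¬ 8 ∣ n → Nat.card (DihedralGroup.cyclicSlopes n) = 1 := fun h => by
    rw [DihedralGroup.cyclicSlopes_eq_singleton h, Nat.card_coe_set_eq, Set.ncard_singleton]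
  refine ⟨fun h8 => ?_, fun h4 h8 => ?_, fun h2 h4 => ?_, fun hodd => ?_⟩
  · have h4 : 4 ∣ n := dvd_trans (by norm_num) h8
    rw [DihedralGroup.ncard_regularNormalizedOfType_of_even hn (dvd_trans (by norm_num) h8)
      (DihedralGroup.mul_totient_half_of_four_dvd h4),
      DihedralGroup.card_cyclicSlopes_of_eight_dvd h8]
  · rw [DihedralGroup.ncard_regularNormalizedOfType_of_even hn (dvd_trans (by norm_num) h4)
      (DihedralGroup.mul_totient_half_of_four_dvd h4), hone h8]
  · rw [DihedralGroup.ncard_regularNormalizedOfType_of_even hn h2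
      (DihedralGroup.mul_totient_half_of_not_four_dvd h2 h4),
      hone fun h8 => h4 (dvd_trans (by norm_num) h8)]
  · exact DihedralGroup.ncard_regularNormalizedOfType_of_odd hn hodd.not_two_dvd_nat
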